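/- Let $N \ge 1$ and $E \in C^3(\mathbb R^N)$. For $x \in \mathbb R^N$ let $\lambda_1(x) \le \lambda_2(x) \le \dots \le \lambda_N(x)$ be the eigenvalues of the Hessian $\nabla^2 E(x)$, counted with multiplicity, and let $v_1(x)$ denote a unit eigenvector for $\lambda_1(x)$ (when $\lambda_1(x)<\lambda_2(x)$ it is unique up to sign, and either sign is allowed). An index-1 saddle is a point $x_*$ with $\nabla E(x_*) = 0$ such that exactly one eigenvalue of $\nabla^2 E(x_*)$, counted with multiplicity, is negative and all the others are positive. For $\varepsilon > 0$ the $\varepsilon$-GAD (Gentlest Ascent Dynamics) is the system $$\dot x = -(I - 2\, v \otimes v)\nabla E(x), \qquad \varepsilon^2 \dot v = -(I - v \otimes v)\nabla^2 E(x)\, v .$$ Suppose that $$\lambda_1(x) < 0 < \lambda_2(x) \quad \text{for all } x \in \mathbb R^N, \qquad \|\nabla E(x)\| \to \infty \ \text{ as } |x| \to \infty$$ (for $N = 1$ the condition on $\lambda_2$ is void). Then for every $r > 0$ there exist $\varepsilon_r > 0$ and $\delta_r > 0$ such that, for every $\varepsilon \in (0, \varepsilon_r]$ and all $x_0, v_0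 \in \mathbb R^N$ with $\|x_0\| \le r$ and $\|v_0 - v_1(x_0)\| \le \delta_r$, the $\varepsilon$-GAD with initial condition $x(0) = x_0$, $v(0) = v_0$ has a unique global solution $(x, v)$ on $[0, \infty)$, which satisfies $\|v(t)\| = 1$ for all $t \ge 0$ if $\|v_0\| = 1$. Moreover this solution converges to an index-1 saddle: there is an index-1 saddle $x_*$ such that, as $t \to \infty$, $x(t) \to x_*$ and $v(t)$ converges to a unit eigenvector of $\nabla^2 E(x_*)$ for $\lambda_1(x_*)$. -/

import Mathlib

open Filter Topology

/-- The Hessian `∇²E(x)`, as the linear map `h ↦ D(∇E)(x)[h]`. -/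
noncomputable def hessian {N : ℕ} (E : EuclideanSpace ℝ (Fin N) → ℝ)
    (x : EuclideanSpace ℝ (Fin N)) :
    EuclideanSpace ℝ (Fin N) →L[ℝ] EuclideanSpace ℝ (Fin N) :=
  fderiv ℝ (gradient E) x

theorem hessian_isSymmetric {N : ℕ} {E : EuclideanSpace ℝ (Fin N) → ℝ}
    (hE : ContDiff ℝ 2 E) (x : EuclideanSpace ℝ (Fin N)) :
    (hessian E x : EuclideanSpace ℝ (Fin N) →ₗ[ℝ] EuclideanSpace ℝ (Fin N)).IsSymmetric := by
  have hd : DifferentiableAt ℝ (fderiv ℝ E) x :=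
    ((hE.fderiv_right (m := 1) (by norm_num)).differentiable (by norm_num)) x
  have key : ∀ u w, inner ℝ (hessian E x u) w = fderiv ℝ (fderiv ℝ E) x u w := by
    intro u w
    let L : StrongDual ℝ (EuclideanSpace ℝ (Fin N)) →L[ℝ] EuclideanSpace ℝ (Fin N) :=
      { toFun := (InnerProductSpace.toDual ℝ (EuclideanSpace ℝ (Fin N))).symm
        map_add' := fun a b => map_add _ a b
        map_smul' := fun c a => by simp
        cont := (InnerProductSpace.toDual ℝ (EuclideanSpace ℝ (Fin N))).symm.continuous }
    have h : hessian E x = L.comp (fderiv ℝ (fderiv ℝ E) x) :=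
      (L.hasFDerivAt.comp x hd.hasFDerivAt).fderiv
    rw [h]
    exact InnerProductSpace.toDual_symm_apply
  have hs : IsSymmSndFDerivAt ℝ E x :=
    hE.contDiffAt.isSymmSndFDerivAt (by simp)
  intro u w
  change inner ℝ (hessian E x u) w = inner ℝ u (hessian E x w)
  rw [key, real_inner_comm, key]
  exact hs u w

/-- The eigenvalues of `∇²E(x)`, repeated with multiplicity and in increasing order: the index `0`
gives `λ₁(x)`, the index `1` gives `λ₂(x)`. (Mathlib lists eigenvalues in decreasing order.) -/
noncomputable def hessianEigenvalue {N : ℕ} {E : EuclideanSpace ℝ (Fin N) → ℝ}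
    (hE : ContDiff ℝ 2 E) (x : EuclideanSpace ℝ (Fin N)) (i : Fin N) : ℝ :=
  (hessian_isSymmetric hE x).eigenvalues finrank_euclideanSpace_fin i.rev

/-- `w` is a choice of `v₁(x)`: a unit eigenvector of `∇²E(x)` for its smallest eigenvalue. -/
def IsLowestEigenvector {N : ℕ} {E : EuclideanSpace ℝ (Fin N) → ℝ} (hN : 0 < N)
    (hE : ContDiff ℝ 2 E) (x w : EuclideanSpace ℝ (Fin N)) : Prop :=
  ‖w‖ = 1 ∧ hessian E x w = hessianEigenvalue hE x ⟨0, hN⟩ • w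

/-- A (non-degenerate) index-1 saddle: a critical point at which exactly one eigenvalue of the
Hessian, counted with multiplicity, is negative and all the others are positive. -/
def IsIndexOneSaddle {N : ℕ} {E : EuclideanSpace ℝ (Fin N) → ℝ}
    (hE : ContDiff ℝ 2 E) (x : EuclideanSpace ℝ (Fin N)) : Prop :=
  gradient E x = 0 ∧
    ∃ i, hessianEigenvalue hE x i < 0 ∧ ∀ j, j ≠ i → 0 < hessianEigenvalue hE x j

/-- `(x, v)` solves the Gentlest Ascent Dynamics with parameter `ε` on `[0, ∞)`,
`x' = -(I - 2 v ⊗ v) ∇E(x)`, `ε² v' = -(I - v ⊗ v) ∇²E(x) v`, with `x(0) = x₀`, `v(0) = v₀`.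
The derivative at `t = 0` is one-sided; values at negative times play no role. -/
structure IsGADSolution {N : ℕ} (E : EuclideanSpace ℝ (Fin N) → ℝ) (ε : ℝ)
    (x₀ v₀ : EuclideanSpace ℝ (Fin N)) (x v : ℝ → EuclideanSpace ℝ (Fin N)) : Prop where
  init_x : x 0 = x₀
  init_v : v 0 = v₀
  deriv_x : ∀ t, 0 ≤ t → HasDerivWithinAt x
    (-(gradient E (x t) - (2 * inner ℝ (v t) (gradient E (x t))) • v t)) (Set.Ici 0) t
  deriv_v : ∀ t, 0 ≤ t → HasDerivWithinAt v
    ((ε ^ 2)⁻¹ • -(hessian E (x t) (v t) - inner ℝ (v t) (hessian E (x t) (v t)) • v t))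
    (Set.Ici 0) t

/-! Write `g = ∇E`, `A = ∇²E(x)`, `q = ⟨v, A v⟩`, and let `w = A v - q v` be the residual
(`eigenResidual`). The proof never follows the eigenvector `v₁(x)` along the trajectory: smallness
of `w` together with `q < 0` certifies that `v` is close enough to the lowest direction. Since `⟨w,
v⟩ = q (1 - ‖v‖²)`, this certificate also controls the norm of `v`
(`rayleigh_bounds_of_norm_eigenResidual_le`), and it makes the reflected form `⟨y, A (I - 2 v ⊗ v)
y⟩` coercive (`le_reflected_form_of_norm_eigenResidual_le`).

Coercivity is used twice. At `y = g` it gives exponential decay of `‖g‖²`. At `y = w` it gives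
damping of `‖w‖²` at a rate of order `ε⁻²`, against a forcing by the motion of the Hessian that is
bounded by a multiple of `‖g‖`. Hence `‖w‖² + a ‖g‖²`, with `a` of order `ε²`, decays
(`GADBounds.exists_hasDerivAt_gadEnergy_le`). For small `ε` it starts below the threshold for `w`,
so the trajectory stays trapped (`GADBounds.mem_gadRegion`).

Trapped velocities decay exponentially, so the trajectory converges to a point with `g = 0`, `w = 0`
and `q < 0`; there `v` is a unit eigenvector of negative eigenvalue (`GADBounds.exists_tendsto`).
All constants come from compactness of a sublevel set of `‖g‖`. -/

/-! ### Integral curves and differential inequalities -/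

section ODE

variable {F : Type*} [NormedAddCommGroup F] [NormedSpace ℝ F]

/-- A bounded Lipschitz autonomous vector field on a Banach space has global integral curves. -/
theorem exists_forall_hasDerivAt_of_lipschitzWith_of_bounded [CompleteSpace F] {f : F → F}
    {K L : NNReal} (hf : LipschitzWith K f) (hb : ∀ z, ‖f z‖ ≤ L) (z₀ : F) :
    ∃ z : ℝ → F, z 0 = z₀ ∧ ∀ t, HasDerivAt z (f (z t)) t := by
  have hloc : ∀ n : ℕ, ∃ α : ℝ → F, α 0 = z₀ ∧
      ∀ t : ℝ, |t| < n + 1 → HasDerivAt α (f (α t)) t := by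
    intro n
    have hn : (0 : ℝ) ≤ n + 1 := by positivity
    -- Speed at most `L` over time `n + 1` confines the curve to radius `L * (n + 1)`, so the
    -- existence time is not shortened.
    have hpl : IsPicardLindelof (fun _ : ℝ => f) (tmin := -((n : ℝ) + 1)) (tmax := (n : ℝ) + 1)
        ⟨0, by constructor <;> linarith⟩ z₀ (L * (n + 1)) 0 L K :=
      { lipschitzOnWith := fun _ _ => hf.lipschitzOnWith
        continuousOn := fun _ _ => continuousOn_const
        norm_le := fun _ _ z _ => hb z
        mul_max_le := by simp }
    obtain ⟨α, hα0, hα⟩ := hpl.exists_eq_forall_mem_Icc_hasDerivWithinAt₀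
    refine ⟨α, hα0, fun t ht => ?_⟩
    rw [abs_lt] at ht
    exact (hα t ⟨ht.1.le, ht.2.le⟩).hasDerivAt (Icc_mem_nhds ht.1 ht.2)
  choose α hα0 hα using hloc
  have huniq : ∀ (m n : ℕ) (t : ℝ), |t| < m + 1 → |t| < n + 1 → α m t = α n t := by
    intro m n t hm hn
    have hpos : (0 : ℝ) < min (m + 1 : ℝ) (n + 1) := by positivity
    refine ODE_solution_unique_of_mem_Ioo (v := fun _ => f) (s := fun _ => Set.univ) (t₀ := 0)
      (a := -min (m + 1 : ℝ) (n + 1)) (b := min (m + 1 : ℝ) (n + 1)) (K := K)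
      (fun _ _ => hf.lipschitzOnWith) ⟨by linarith, hpos⟩ ?_ ?_ (by rw [hα0, hα0]) ?_
    · exact fun s hs => ⟨hα m s (abs_lt.2 ⟨by linarith [hs.1, min_le_left (m + 1 : ℝ) (n + 1)],
        hs.2.trans_le (min_le_left _ _)⟩), trivial⟩
    · exact fun s hs => ⟨hα n s (abs_lt.2 ⟨by linarith [hs.1, min_le_right (m + 1 : ℝ) (n + 1)],
        hs.2.trans_le (min_le_right _ _)⟩), trivial⟩
    · exact abs_lt.1 (lt_min hm hn)
  have hceil : ∀ t : ℝ, |t| < (⌈|t|⌉₊ : ℝ) + 1 := fun t =>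
    (Nat.le_ceil _).trans_lt (lt_add_one _)
  refine ⟨fun t => α ⌈|t|⌉₊ t, hα0 _, fun t => ?_⟩
  refine (hα ⌈|t|⌉₊ t (hceil t)).congr_of_eventuallyEq ?_
  filter_upwards [(continuous_abs.tendsto t).eventually (gt_mem_nhds (hceil t))] with s hs
  exact huniq _ _ s (hceil s) hs

/-- Integral curves of a `C¹` autonomous vector field on `[0, ∞)` are determined by their initial
value. -/
theorem eq_of_hasDerivWithinAt_Ici_of_contDiff [FiniteDimensional ℝ F] {f : F → F}
    (hf : ContDiff ℝ 1 f) {y z : ℝ → F} (h₀ : y 0 = z 0)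
    (hy : ∀ t, 0 ≤ t → HasDerivWithinAt y (f (y t)) (Set.Ici 0) t)
    (hz : ∀ t, 0 ≤ t → HasDerivWithinAt z (f (z t)) (Set.Ici 0) t) {t : ℝ} (ht : 0 ≤ t) :
    y t = z t := by
  have cont : ∀ {u : ℝ → F}, (∀ t, 0 ≤ t → HasDerivWithinAt u (f (u t)) (Set.Ici 0) t) →
      ContinuousOn u (Set.Icc 0 t) := fun hu s hs =>
    ((hu s hs.1).continuousWithinAt).mono Set.Icc_subset_Ici_self
  -- Both curves have compact image on `[0, t]`, hence share a ball, on which a `C¹` field is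
  -- Lipschitz.
  obtain ⟨R, hR⟩ := ((isCompact_Icc.image_of_continuousOn (cont hy)).union
    (isCompact_Icc.image_of_continuousOn (cont hz))).isBounded.subset_closedBall 0
  obtain ⟨K, hK⟩ := hf.contDiffOn.exists_lipschitzOnWith (s := Metric.closedBall (0 : F) R)
    (by norm_num) (convex_closedBall 0 R) (isCompact_closedBall 0 R)
  exact ODE_solution_unique_of_mem_Icc_right (v := fun _ => f)
    (s := fun _ => Metric.closedBall (0 : F) R) (fun _ _ => hK) (cont hy)
    (fun s hs => (hy s hs.1).mono (Set.Ici_subset_Ici.2 hs.1))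
    (fun s hs => hR (Or.inl ⟨s, Set.Ico_subset_Icc_self hs, rfl⟩)) (cont hz)
    (fun s hs => (hz s hs.1).mono (Set.Ici_subset_Ici.2 hs.1))
    (fun s hs => hR (Or.inr ⟨s, Set.Ico_subset_Icc_self hs, rfl⟩)) h₀ ⟨ht, le_rfl⟩

/-- A curve that starts in an open set and cannot be the first to leave it never leaves it. -/
theorem forall_mem_of_isOpen_of_forall_Ico {X : Type*} [TopologicalSpace X] {z : ℝ → X}
    (hz : Continuous z) {U : Set X} (hU : IsOpen U) (h₀ : z 0 ∈ U)
    (h : ∀ T, 0 < T → (∀ t ∈ Set.Ico 0 T, z t ∈ U) → z T ∈ U) : ∀ t, 0 ≤ t → z t ∈ U := by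
  by_contra! hne
  have hcl : IsClosed {t : ℝ | 0 ≤ t ∧ z t ∉ U} :=
    isClosed_Ici.inter (hU.isClosed_compl.preimage hz)
  have hbd : BddBelow {t : ℝ | 0 ≤ t ∧ z t ∉ U} := ⟨0, fun t ht => ht.1⟩
  have hT := hcl.csInf_mem hne hbd
  set T := sInf {t : ℝ | 0 ≤ t ∧ z t ∉ U}
  have hT0 : T ≠ 0 := fun h0 => hT.2 (h0 ▸ h₀)
  refine hT.2 (h T (lt_of_le_of_ne hT.1 hT0.symm) fun t ht => ?_)
  by_contra htU
  exact absurd (csInf_le hbd ⟨ht.1, htU⟩) (not_le.2 ht.2)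

/-- The product `exp (k t) f t` is antitone. Derivatives are needed only on the open interval, so
the bound reaches a possible exit time `T` by continuity alone. -/
theorem le_mul_exp_of_hasDerivAt_le {f f' : ℝ → ℝ} (hf : Continuous f) {k T : ℝ} (hT : 0 ≤ T)
    (hd : ∀ t ∈ Set.Ioo 0 T, HasDerivAt f (f' t) t) (hle : ∀ t ∈ Set.Ioo 0 T, f' t ≤ -(k * f t)) :
    f T ≤ f 0 * Real.exp (-(k * T)) := by
  have hd' : ∀ t ∈ Set.Ioo 0 T, HasDerivAt (fun s => Real.exp (k * s) * f s)
      (Real.exp (k * t) * k * f t + Real.exp (k * t) * f' t) t := by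
    intro t ht
    have h1 : HasDerivAt (fun s : ℝ => Real.exp (k * s)) (Real.exp (k * t) * k) t := by
      simpa using ((hasDerivAt_id t).const_mul k).exp
    exact h1.mul (hd t ht)
  have hanti : AntitoneOn (fun s => Real.exp (k * s) * f s) (Set.Icc 0 T) := by
    refine antitoneOn_of_deriv_nonpos (convex_Icc 0 T) (by fun_prop) ?_ ?_
    · rw [interior_Icc]
      exact fun t ht => (hd' t ht).differentiableAt.differentiableWithinAt
    · rw [interior_Icc]
      intro t ht
      rw [(hd' t ht).deriv]
      nlinarith [hle t ht, Real.exp_pos (k * t)]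
  have := hanti ⟨le_rfl, hT⟩ ⟨hT, le_rfl⟩ hT
  simp only [mul_zero, Real.exp_zero, one_mul] at this
  rw [Real.exp_neg, ← div_eq_mul_inv, le_div_iff₀ (Real.exp_pos _)]
  linarith

/-- A curve with exponentially decaying velocity converges. -/
theorem exists_tendsto_of_norm_deriv_le_exp [CompleteSpace F] {z z' : ℝ → F} {C k : ℝ}
    (hk : 0 < k) (hz : ∀ t, 0 ≤ t → HasDerivAt z (z' t) t) (hc : ContinuousOn z' (Set.Ioi 0))
    (hle : ∀ t, 0 ≤ t → ‖z' t‖ ≤ C * Real.exp (-k * t)) :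
    ∃ l, Tendsto z atTop (𝓝 l) := by
  refine ⟨_, MeasureTheory.tendsto_limUnder_of_hasDerivAt_of_integrableOn_Ioi (a := 0) (f' := z')
    (fun t ht => hz t (le_of_lt ht)) ?_⟩
  refine MeasureTheory.Integrable.mono' ((exp_neg_integrableOn_Ioi 0 hk).const_mul C)
    (hc.aestronglyMeasurable measurableSet_Ioi) ?_
  filter_upwards [MeasureTheory.ae_restrict_mem measurableSet_Ioi] with t ht
  exact hle t (le_of_lt ht)

end ODE

/-! ### Approximate eigenvectors and the reflected form -/

section LinearAlgebra

variable {V : Type*} [NormedAddCommGroup V] [InnerProductSpace ℝ V]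

open scoped InnerProductSpace

/-- The component `A v - ⟨v, A v⟩ v` that drives the direction `v` of the dynamics. -/
noncomputable def eigenResidual (A : V →L[ℝ] V) (v : V) : V :=
  A v - ⟪v, A v⟫_ℝ • v

/-- This links the residual to the defect of normalization: when the Rayleigh quotient is bounded
away from `0`, a small residual forces `‖v‖` close to `1`. -/
theorem inner_eigenResidual_self (A : V →L[ℝ] V) (v : V) :
    ⟪eigenResidual A v, v⟫_ℝ = ⟪v, A v⟫_ℝ * (1 - ‖v‖ ^ 2) := by
  rw [eigenResidual, inner_sub_left, real_inner_smul_left, real_inner_self_eq_norm_sq,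
    real_inner_comm]
  ring

/-- A vector with small residual and nonpositive Rayleigh quotient is almost normalized, with
Rayleigh quotient bounded away from `0`. -/
theorem rayleigh_bounds_of_norm_eigenResidual_le {A : V →L[ℝ] V} {v : V} {m : ℝ} (hm : 0 < m)
    (hA : m * ‖v‖ ≤ ‖A v‖) (hw : ‖eigenResidual A v‖ ≤ m / 16) (hq : ⟪v, A v⟫_ℝ ≤ 0)
    (hv₁ : 1 / 2 ≤ ‖v‖ ^ 2) (hv₂ : ‖v‖ ^ 2 ≤ 2) :
    ⟪v, A v⟫_ℝ ≤ -(m / 2) ∧ 3 / 4 ≤ ‖v‖ ^ 2 ∧ ‖v‖ ^ 2 ≤ 5 / 4 := by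
  have hv₁' : 1 / 2 ≤ ‖v‖ := by nlinarith [norm_nonneg v]
  have hv₂' : ‖v‖ ≤ 3 / 2 := by nlinarith [norm_nonneg v]
  have h1 : ‖A v‖ ≤ ‖eigenResidual A v‖ + -⟪v, A v⟫_ℝ * ‖v‖ := by
    calc ‖A v‖ = ‖eigenResidual A v + ⟪v, A v⟫_ℝ • v‖ := by rw [eigenResidual, sub_add_cancel]
      _ ≤ ‖eigenResidual A v‖ + ‖⟪v, A v⟫_ℝ • v‖ := norm_add_le _ _
      _ = _ := by rw [norm_smul, Real.norm_of_nonpos hq]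
  have hq' : ⟪v, A v⟫_ℝ ≤ -(m / 2) := by
    by_contra! hlt
    nlinarith
  have h2 : |⟪v, A v⟫_ℝ * (1 - ‖v‖ ^ 2)| ≤ m / 16 * (3 / 2) := by
    rw [← inner_eigenResidual_self]
    exact (abs_real_inner_le_norm _ _).trans
      (mul_le_mul hw hv₂' (norm_nonneg _) (by positivity))
  rw [abs_le] at h2
  refine ⟨hq', ?_, ?_⟩ <;> by_contra! hlt <;> nlinarith

/-- If `A` is positive on the hyperplane `e^⊥`, then it is positive on `v^⊥` for every approximate
eigenvector `v` with negative Rayleigh quotient. -/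
theorem le_inner_of_inner_eq_zero_of_norm_eigenResidual_le {A : V →L[ℝ] V}
    (hA : (A : V →ₗ[ℝ] V).IsSymmetric) {e v : V} {m : ℝ} (hm : 0 < m)
    (he : ∀ z, ⟪e, z⟫_ℝ = 0 → m * ‖z‖ ^ 2 ≤ ⟪z, A z⟫_ℝ) (hw : ‖eigenResidual A v‖ ≤ m / 16)
    (hq : ⟪v, A v⟫_ℝ ≤ -(m / 2)) {b : V} (hb : ⟪b, v⟫_ℝ = 0) :
    m / 2 * ‖b‖ ^ 2 ≤ ⟪b, A b⟫_ℝ := by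
  -- Otherwise `v` would lie in `e^⊥`, where the form is nonnegative, against `q < 0`. Thus `b` can
  -- be moved into `e^⊥` along `v`.
  have hev : ⟪e, v⟫_ℝ ≠ 0 := fun h => by nlinarith [he v h, sq_nonneg ‖v‖]
  obtain ⟨p, hp⟩ : ∃ p, p = ⟪e, b⟫_ℝ / ⟪e, v⟫_ℝ := ⟨_, rfl⟩
  have hz : ⟪e, b - p • v⟫_ℝ = 0 := by
    rw [inner_sub_right, real_inner_smul_right, hp, div_mul_cancel₀ _ hev, sub_self]
  have hbw : ⟪b, A v⟫_ℝ = ⟪b, eigenResidual A v⟫_ℝ := by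
    rw [eigenResidual, inner_sub_right, real_inner_smul_right, hb, mul_zero, sub_zero]
  have hvb : ⟪v, A b⟫_ℝ = ⟪b, A v⟫_ℝ := by
    rw [real_inner_comm]; exact hA b v
  have h1 := he _ hz
  have h2 : ⟪b - p • v, A (b - p • v)⟫_ℝ =
      ⟪b, A b⟫_ℝ - 2 * p * ⟪b, eigenResidual A v⟫_ℝ + p ^ 2 * ⟪v, A v⟫_ℝ := by
    simp only [map_sub, map_smul, inner_sub_left, inner_sub_right, real_inner_smul_left,
      real_inner_smul_right, hvb, hbw]
    ring
  have h3 : ‖b - p • v‖ ^ 2 = ‖b‖ ^ 2 + p ^ 2 * ‖v‖ ^ 2 := by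
    rw [norm_sub_sq_real, real_inner_smul_right, hb, norm_smul, mul_pow, Real.norm_eq_abs, sq_abs]
    ring
  have h4 : |p * ⟪b, eigenResidual A v⟫_ℝ| ≤ |p| * (‖b‖ * (m / 16)) := by
    rw [abs_mul]
    gcongr
    exact (abs_real_inner_le_norm _ _).trans (by gcongr)
  have h5 := (abs_le.1 h4).1
  rw [h2, h3] at h1
  nlinarith [mul_nonneg hm.le (sq_nonneg (|p| - ‖b‖)), sq_abs p, mul_nonneg hm.le (sq_nonneg p),
    mul_nonneg hm.le (sq_nonneg ‖b‖), mul_nonneg hm.le (mul_nonneg (sq_nonneg p) (sq_nonneg ‖v‖)),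
    mul_nonneg (sq_nonneg p) (sub_nonneg.2 hq)]

/-- Coercivity of the reflected Hessian form `⟨y, A (I - 2 v ⊗ v) y⟩`. -/
theorem le_reflected_form_of_norm_eigenResidual_le {A : V →L[ℝ] V}
    (hA : (A : V →ₗ[ℝ] V).IsSymmetric) {e v : V} {m : ℝ} (hm : 0 < m)
    (he : ∀ z, ⟪e, z⟫_ℝ = 0 → m * ‖z‖ ^ 2 ≤ ⟪z, A z⟫_ℝ) (hw : ‖eigenResidual A v‖ ≤ m / 16)
    (hq : ⟪v, A v⟫_ℝ ≤ -(m / 2)) (hv₁ : 3 / 4 ≤ ‖v‖ ^ 2) (hv₂ : ‖v‖ ^ 2 ≤ 5 / 4) (y : V) :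
    m / 16 * ‖y‖ ^ 2 ≤ ⟪y, A y⟫_ℝ - 2 * ⟪v, y⟫_ℝ * ⟪A v, y⟫_ℝ := by
  -- Split `y = b + α v` with `b ⊥ v`. The form becomes `⟨b, A b⟩ + 2 α (1 - ‖v‖²) ⟨b, w⟩ - α² q (2
  -- ‖v‖² - 1)`: the outer terms are positive, and the cross term is small because `w` is.
  obtain ⟨α, hα⟩ : ∃ α, α = ⟪v, y⟫_ℝ / ‖v‖ ^ 2 := ⟨_, rfl⟩
  obtain ⟨b, hb⟩ : ∃ b, b = y - α • v := ⟨_, rfl⟩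
  have hy : y = b + α • v := by rw [hb, sub_add_cancel]
  have hbv : ⟪b, v⟫_ℝ = 0 := by
    rw [hb, inner_sub_left, real_inner_smul_left, real_inner_self_eq_norm_sq, hα,
      div_mul_cancel₀ _ (by linarith), real_inner_comm, sub_self]
  have hvb : ⟪v, b⟫_ℝ = 0 := by rw [real_inner_comm, hbv]
  have hbb := le_inner_of_inner_eq_zero_of_norm_eigenResidual_le hA hm he hw hq hbv
  have hbw : ⟪b, A v⟫_ℝ = ⟪b, eigenResidual A v⟫_ℝ := by
    rw [eigenResidual, inner_sub_right, real_inner_smul_right, hbv, mul_zero, sub_zero]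
  have hvAb : ⟪v, A b⟫_ℝ = ⟪b, A v⟫_ℝ := by
    rw [real_inner_comm]; exact hA b v
  have hvy : ⟪v, y⟫_ℝ = α * ‖v‖ ^ 2 := by
    rw [hy, inner_add_right, real_inner_smul_right, hvb, real_inner_self_eq_norm_sq, zero_add]
  have h1 : ⟪A v, y⟫_ℝ = ⟪b, eigenResidual A v⟫_ℝ + α * ⟪v, A v⟫_ℝ := by
    rw [hy, real_inner_comm, inner_add_left, real_inner_smul_left, hbw]
  have h2 : ⟪y, A y⟫_ℝ = ⟪b, A b⟫_ℝ + 2 * α * ⟪b, eigenResidual A v⟫_ℝ + α ^ 2 * ⟪v, A v⟫_ℝ := by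
    rw [hy]
    simp only [map_add, map_smul, inner_add_left, inner_add_right, real_inner_smul_left,
      real_inner_smul_right, hvAb, hbw]
    ring
  have h3 : ‖y‖ ^ 2 = ‖b‖ ^ 2 + α ^ 2 * ‖v‖ ^ 2 := by
    rw [hy, norm_add_sq_real, real_inner_smul_right, hbv, norm_smul, mul_pow, Real.norm_eq_abs,
      sq_abs]
    ring
  have h4 : |α * ⟪b, eigenResidual A v⟫_ℝ| ≤ |α| * (‖b‖ * (m / 16)) := by
    rw [abs_mul]
    gcongr
    exact (abs_real_inner_le_norm _ _).trans (by gcongr)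
  have h5 : |(1 - ‖v‖ ^ 2) * (α * ⟪b, eigenResidual A v⟫_ℝ)| ≤ 1 * (|α| * (‖b‖ * (m / 16))) := by
    rw [abs_mul]
    gcongr
    rw [abs_le]
    constructor <;> linarith
  have h6 := (abs_le.1 h5).1
  have h7 : |α| * (‖b‖ * (m / 16)) ≤ m / 32 * (α ^ 2 + ‖b‖ ^ 2) := by
    nlinarith [mul_nonneg hm.le (sq_nonneg (|α| - ‖b‖)), sq_abs α]
  have h8 : m / 4 * α ^ 2 ≤ α ^ 2 * -⟪v, A v⟫_ℝ * (2 * ‖v‖ ^ 2 - 1) := by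
    have : m / 2 * (1 / 2) ≤ -⟪v, A v⟫_ℝ * (2 * ‖v‖ ^ 2 - 1) :=
      mul_le_mul (by linarith) (by linarith) (by norm_num) (by linarith)
    nlinarith [sq_nonneg α]
  have h9 : m * (α ^ 2 * ‖v‖ ^ 2) ≤ m * (α ^ 2 * (5 / 4)) := by gcongr
  rw [h2, hvy, h1, h3]
  nlinarith [mul_nonneg hm.le (sq_nonneg α), mul_nonneg hm.le (sq_nonneg ‖b‖)]

end LinearAlgebra

/-! ### Spectrum of the Hessian -/

section Spectrum

variable {N : ℕ} {E : EuclideanSpace ℝ (Fin N) → ℝ} (hE : ContDiff ℝ 2 E)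
  (x : EuclideanSpace ℝ (Fin N))

open scoped InnerProductSpace

theorem hessianEigenvalue_monotone : Monotone (hessianEigenvalue hE x) := fun _ _ hij =>
  (hessian_isSymmetric hE x).eigenvalues_antitone finrank_euclideanSpace_fin
    (Fin.rev_le_rev.2 hij)

variable {hE x} in
theorem hessianEigenvalue_pos (hN : 0 < N)
    (h₂ : ∀ h : 2 ≤ N, 0 < hessianEigenvalue hE x ⟨1, h⟩) {j : Fin N} (hj : j ≠ ⟨0, hN⟩) :
    0 < hessianEigenvalue hE x j := by
  have hj0 : (j : ℕ) ≠ 0 := fun h => hj (Fin.ext h)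
  have hN2 : 2 ≤ N := by omega
  exact (h₂ hN2).trans_le (hessianEigenvalue_monotone hE x (Fin.mk_le_of_le_val (by omega)))

/-- An orthonormal eigenbasis of the Hessian, indexed in increasing order of eigenvalues. -/
noncomputable def hessianEigenbasis :
    OrthonormalBasis (Fin N) ℝ (EuclideanSpace ℝ (Fin N)) :=
  ((hessian_isSymmetric hE x).eigenvectorBasis finrank_euclideanSpace_fin).reindex Fin.revPerm

theorem hessian_hessianEigenbasis (i : Fin N) :
    hessian E x (hessianEigenbasis hE x i) =
      hessianEigenvalue hE x i • hessianEigenbasis hE x i := by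
  have := (hessian_isSymmetric hE x).apply_eigenvectorBasis finrank_euclideanSpace_fin i.rev
  rw [hessianEigenbasis, OrthonormalBasis.reindex_apply]
  exact this

theorem inner_hessianEigenbasis_hessian (i : Fin N) (z : EuclideanSpace ℝ (Fin N)) :
    ⟪hessianEigenbasis hE x i, hessian E x z⟫_ℝ =
      hessianEigenvalue hE x i * ⟪hessianEigenbasis hE x i, z⟫_ℝ := by
  rw [← real_inner_smul_left, ← hessian_hessianEigenbasis]
  exact (hessian_isSymmetric hE x _ _).symm

variable {hE x}

theorem hessian_injective (h : ∀ i, hessianEigenvalue hE x i ≠ 0)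
    {y : EuclideanSpace ℝ (Fin N)} (hy : hessian E x y = 0) : y = 0 := by
  refine InnerProductSpace.ext_inner_left_basis
    (hessianEigenbasis hE x).toBasis fun i => ?_
  have := inner_hessianEigenbasis_hessian hE x i y
  rw [hy, inner_zero_right] at this
  simpa using (mul_eq_zero.1 this.symm).resolve_left (h i)

/-- On the orthogonal complement of the lowest eigenvector, the Hessian is bounded below by any
lower bound for the moduli of its eigenvalues. -/
theorem le_inner_hessian_of_inner_eq_zero {i : Fin N}
    (hpos : ∀ j, j ≠ i → 0 < hessianEigenvalue hE x j) {m : ℝ}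
    (hm : ∀ y, m * ‖y‖ ≤ ‖hessian E x y‖) {z : EuclideanSpace ℝ (Fin N)}
    (hz : ⟪hessianEigenbasis hE x i, z⟫_ℝ = 0) : m * ‖z‖ ^ 2 ≤ ⟪z, hessian E x z⟫_ℝ := by
  rw [← (hessianEigenbasis hE x).sum_sq_norm_inner_right z,
    ← (hessianEigenbasis hE x).sum_inner_mul_inner z, Finset.mul_sum]
  refine Finset.sum_le_sum fun j _ => ?_
  rw [inner_hessianEigenbasis_hessian, real_inner_comm _ z, Real.norm_eq_abs, sq_abs]
  by_cases hj : j = i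
  · rw [hj, hz]; simp
  -- On a unit eigenvector the lower bound reads `m ≤ |λ_j| = λ_j`.
  · have h1 := hm (hessianEigenbasis hE x j)
    rw [hessian_hessianEigenbasis, norm_smul, (hessianEigenbasis hE x).norm_eq_one,
      Real.norm_of_nonneg (hpos j hj).le, mul_one, mul_one] at h1
    nlinarith [sq_nonneg ⟪hessianEigenbasis hE x j, z⟫_ℝ]

/-- When only one eigenvalue is not positive, every eigenvector for a negative number belongs to
that eigenvalue. -/
theorem eq_hessianEigenvalue_of_neg {i : Fin N}
    (hpos : ∀ j, j ≠ i → 0 < hessianEigenvalue hE x j) {q : ℝ} (hq : q < 0)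
    {v : EuclideanSpace ℝ (Fin N)} (hv : v ≠ 0) (h : hessian E x v = q • v) :
    q = hessianEigenvalue hE x i := by
  by_contra hne
  refine hv (InnerProductSpace.ext_inner_left_basis
    (hessianEigenbasis hE x).toBasis fun j => ?_)
  have h1 := inner_hessianEigenbasis_hessian hE x j v
  rw [h, real_inner_smul_right] at h1
  have hj : q ≠ hessianEigenvalue hE x j := by
    by_cases hj : j = i
    · rwa [hj]
    · exact (hq.trans (hpos j hj)).ne
  have h2 : (q - hessianEigenvalue hE x j) * ⟪hessianEigenbasis hE x j, v⟫_ℝ = 0 := by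
    rw [sub_mul, h1, sub_self]
  simpa using (mul_eq_zero.1 h2).resolve_left (sub_ne_zero.2 hj)

end Spectrum

/-! ### Dissipation estimates in the trapping region -/

section Dynamics

variable {V : Type*} [NormedAddCommGroup V] [InnerProductSpace ℝ V]

open scoped InnerProductSpace

/-- The vector field of the Gentlest Ascent Dynamics for the gradient field `g`. -/
noncomputable def gadField (g : V → V) (ε : ℝ) (z : V × V) : V × V :=
  (-(g z.1 - (2 * ⟪z.2, g z.1⟫_ℝ) • z.2), (ε ^ 2)⁻¹ • -eigenResidual (fderiv ℝ g z.1) z.2)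

theorem contDiff_eigenResidual_fderiv {g : V → V} (hg : ContDiff ℝ 2 g) :
    ContDiff ℝ 1 fun z : V × V => eigenResidual (fderiv ℝ g z.1) z.2 := by
  have hA : ContDiff ℝ 1 fun z : V × V => fderiv ℝ g z.1 z.2 :=
    ((hg.fderiv_right (m := 1) (by norm_num)).comp contDiff_fst).clm_apply contDiff_snd
  exact hA.sub ((contDiff_snd.inner ℝ hA).smul contDiff_snd)

theorem contDiff_gadField {g : V → V} (hg : ContDiff ℝ 2 g) (ε : ℝ) :
    ContDiff ℝ 1 (gadField g ε) := by
  have hg' : ContDiff ℝ 1 fun z : V × V => g z.1 := (hg.of_le (by norm_num)).comp contDiff_fst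
  exact (hg'.sub ((contDiff_const.mul (contDiff_snd.inner ℝ hg')).smul contDiff_snd)).neg.prodMk
    (contDiff_const.smul (contDiff_eigenResidual_fderiv hg).neg)

theorem HasDerivAt.eigenResidual {A : ℝ → V →L[ℝ] V} {A' : V →L[ℝ] V} {v : ℝ → V} {v' : V}
    {t : ℝ} (hA : HasDerivAt A A' t) (hv : HasDerivAt v v' t) :
    HasDerivAt (fun s => eigenResidual (A s) (v s))
      (A' (v t) + A t v' - (⟪v t, A t (v t)⟫_ℝ • v' +
        (⟪v t, A' (v t) + A t v'⟫_ℝ + ⟪v', A t (v t)⟫_ℝ) • v t)) t :=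
  (hA.clm_apply hv).sub ((hv.inner ℝ (hA.clm_apply hv)).smul hv)

theorem norm_gadField_fst_le (u v : V) (hv : ‖v‖ ^ 2 ≤ 5 / 4) :
    ‖-(u - (2 * ⟪v, u⟫_ℝ) • v)‖ ≤ 4 * ‖u‖ := by
  rw [norm_neg]
  have h1 : |⟪v, u⟫_ℝ| ≤ ‖v‖ * ‖u‖ := abs_real_inner_le_norm v u
  calc ‖u - (2 * ⟪v, u⟫_ℝ) • v‖ ≤ ‖u‖ + ‖(2 * ⟪v, u⟫_ℝ) • v‖ := norm_sub_le _ _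
    _ = ‖u‖ + 2 * |⟪v, u⟫_ℝ| * ‖v‖ := by
      rw [norm_smul, Real.norm_eq_abs, abs_mul, abs_of_pos (two_pos : (0 : ℝ) < 2)]
    _ ≤ ‖u‖ + 2 * (‖v‖ * ‖u‖) * ‖v‖ := by gcongr
    _ = ‖u‖ + 2 * ‖v‖ ^ 2 * ‖u‖ := by ring
    _ ≤ ‖u‖ + 2 * (5 / 4) * ‖u‖ := by gcongr
    _ ≤ 4 * ‖u‖ := by linarith [norm_nonneg u]

/-- Along the flow the left side is half the derivative of `‖g‖²`, with `u = g`; the right side is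
the negative of the coercive reflected form. -/
theorem inner_apply_gad_eq (A : V →L[ℝ] V) (u v : V) :
    ⟪u, A (-(u - (2 * ⟪v, u⟫_ℝ) • v))⟫_ℝ = -(⟪u, A u⟫_ℝ - 2 * ⟪v, u⟫_ℝ * ⟪A v, u⟫_ℝ) := by
  simp only [map_neg, map_sub, map_smul, inner_neg_right, inner_sub_right, real_inner_smul_right,
    real_inner_comm u (A v)]

/-- Dissipation of the residual along the dynamics, up to the motion `B` of the Hessian. -/
theorem inner_eigenResidual_deriv_le {A B : V →L[ℝ] V} (hA : (A : V →ₗ[ℝ] V).IsSymmetric)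
    {v : V} {c b κ : ℝ} (hκ : 0 ≤ κ)
    (hcoer : ∀ y, c * ‖y‖ ^ 2 ≤ ⟪y, A y⟫_ℝ - 2 * ⟪v, y⟫_ℝ * ⟪A v, y⟫_ℝ)
    (hq : ⟪v, A v⟫_ℝ ≤ 0) (hv : ‖v‖ ^ 2 ≤ 5 / 4) (hB : ‖B‖ ≤ b) :
    ⟪eigenResidual A v, B v + A (κ • -eigenResidual A v) -
      (⟪v, A v⟫_ℝ • (κ • -eigenResidual A v) +
        (⟪v, B v + A (κ • -eigenResidual A v)⟫_ℝ + ⟪κ • -eigenResidual A v, A v⟫_ℝ) • v)⟫_ℝ ≤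
      -(κ * c * ‖eigenResidual A v‖ ^ 2) + 3 * b * ‖eigenResidual A v‖ := by
  set w := eigenResidual A v
  have hb : 0 ≤ b := (norm_nonneg B).trans hB
  have hvAw : ⟪v, A w⟫_ℝ = ⟪A v, w⟫_ℝ := (hA v w).symm
  -- By symmetry of `A` the stiff terms combine into the reflected form at `w` and the further
  -- damping term `κ q ‖w‖²`; only the terms in `B` remain as forcing.
  have heq : ⟪w, B v + A (κ • -w) - (⟪v, A v⟫_ℝ • (κ • -w) +
      (⟪v, B v + A (κ • -w)⟫_ℝ + ⟪κ • -w, A v⟫_ℝ) • v)⟫_ℝ =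
      -(κ * (⟪w, A w⟫_ℝ - 2 * ⟪v, w⟫_ℝ * ⟪A v, w⟫_ℝ)) + κ * ⟪v, A v⟫_ℝ * ‖w‖ ^ 2 +
        (⟪w, B v⟫_ℝ - ⟪v, B v⟫_ℝ * ⟪v, w⟫_ℝ) := by
    simp only [map_neg, map_smul, inner_add_right, inner_sub_right, real_inner_smul_right,
      inner_neg_right, real_inner_smul_left, inner_neg_left, real_inner_self_eq_norm_sq,
      hvAw, real_inner_comm w (A v), real_inner_comm w v]
    rw [real_inner_comm (A v) w]
    ring
  have hv' : ‖v‖ ≤ 9 / 8 := by nlinarith [norm_nonneg v]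
  have hBv : ‖B v‖ ≤ b * ‖v‖ := B.le_of_opNorm_le hB v
  have h1 : ⟪w, B v⟫_ℝ ≤ ‖w‖ * (b * ‖v‖) := (real_inner_le_norm _ _).trans (by gcongr)
  have h2 : |⟪v, B v⟫_ℝ * ⟪v, w⟫_ℝ| ≤ ‖v‖ * (b * ‖v‖) * (‖v‖ * ‖w‖) := by
    rw [abs_mul]
    gcongr
    · exact (abs_real_inner_le_norm _ _).trans (by gcongr)
    · exact abs_real_inner_le_norm _ _
  have h3 : ‖w‖ * (b * ‖v‖) + ‖v‖ * (b * ‖v‖) * (‖v‖ * ‖w‖) ≤ 3 * b * ‖w‖ := by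
    have h4 : ‖v‖ * (1 + ‖v‖ ^ 2) ≤ 3 := by nlinarith [norm_nonneg v]
    have h5 : 0 ≤ b * ‖w‖ := by positivity
    nlinarith
  have h6 := mul_le_mul_of_nonneg_left (hcoer w) hκ
  have h7 : κ * ⟪v, A v⟫_ℝ * ‖w‖ ^ 2 ≤ 0 :=
    mul_nonpos_of_nonpos_of_nonneg (mul_nonpos_of_nonneg_of_nonpos hκ hq) (sq_nonneg _)
  rw [heq]
  linarith [(abs_le.1 h2).1]

/-- Uniform bounds on the sublevel set `{‖g‖ ≤ M}` for a gradient field `g` whose derivative has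
one negative eigenvalue and is otherwise positive. -/
structure GADBounds (g : V → V) (M m D : ℝ) : Prop where
  contDiff : ContDiff ℝ 2 g
  isSymmetric : ∀ x, (fderiv ℝ g x : V →ₗ[ℝ] V).IsSymmetric
  m_pos : 0 < m
  D_nonneg : 0 ≤ D
  le_norm : ∀ x, ‖g x‖ ≤ M → ∀ y, m * ‖y‖ ≤ ‖fderiv ℝ g x y‖
  exists_le_inner : ∀ x, ‖g x‖ ≤ M → ∃ e, ∀ z, ⟪e, z⟫_ℝ = 0 → m * ‖z‖ ^ 2 ≤ ⟪z, fderiv ℝ g x z⟫_ℝ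
  norm_le : ∀ x, ‖g x‖ ≤ M → ‖fderiv ℝ (fderiv ℝ g) x‖ ≤ D

/-- States near which the direction is an approximate lowest eigenvector. -/
def gadRegion (g : V → V) (M m : ℝ) : Set (V × V) :=
  {z | ‖g z.1‖ < M ∧ ‖eigenResidual (fderiv ℝ g z.1) z.2‖ < m / 16 ∧
    ⟪z.2, fderiv ℝ g z.1 z.2⟫_ℝ < 0 ∧ 1 / 2 < ‖z.2‖ ^ 2 ∧ ‖z.2‖ ^ 2 < 2}

/-- The closed analogue of `gadRegion`. -/
def gadClosedRegion (g : V → V) (M m : ℝ) : Set (V × V) :=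
  {z | ‖g z.1‖ ≤ M ∧ ‖eigenResidual (fderiv ℝ g z.1) z.2‖ ≤ m / 16 ∧
    ⟪z.2, fderiv ℝ g z.1 z.2⟫_ℝ ≤ 0 ∧ 1 / 2 ≤ ‖z.2‖ ^ 2 ∧ ‖z.2‖ ^ 2 ≤ 2}

theorem gadRegion_subset_gadClosedRegion (g : V → V) (M m : ℝ) :
    gadRegion g M m ⊆ gadClosedRegion g M m := fun _ h =>
  ⟨h.1.le, h.2.1.le, h.2.2.1.le, h.2.2.2.1.le, h.2.2.2.2.le⟩

/-- The Lyapunov function controlling the residual. -/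
noncomputable def gadEnergy (g : V → V) (a : ℝ) (z : V × V) : ℝ :=
  ‖eigenResidual (fderiv ℝ g z.1) z.2‖ ^ 2 + a * ‖g z.1‖ ^ 2

/-- The weight of the gradient in the Lyapunov function. -/
noncomputable def gadWeight (ε m D : ℝ) : ℝ := ε ^ 2 * (12 * D) ^ 2 / (m / 16) ^ 2

theorem gadWeight_nonneg (ε m D : ℝ) : 0 ≤ gadWeight ε m D := by
  unfold gadWeight; positivity

theorem continuous_inner_fderiv_apply {g : V → V} (hg : ContDiff ℝ 2 g) :
    Continuous fun z : V × V => ⟪z.2, fderiv ℝ g z.1 z.2⟫_ℝ := by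
  have h := (hg.continuous_fderiv (by norm_num)).comp (continuous_fst (X := V) (Y := V))
  exact continuous_snd.inner (h.clm_apply continuous_snd)

theorem isOpen_gadRegion {g : V → V} (hg : ContDiff ℝ 2 g) (M m : ℝ) :
    IsOpen (gadRegion g M m) := by
  have h1 := (hg.continuous.comp (continuous_fst (X := V) (Y := V))).norm
  have h2 := (contDiff_eigenResidual_fderiv hg).continuous.norm
  have h3 := continuous_inner_fderiv_apply hg
  have h4 : Continuous fun z : V × V => ‖z.2‖ ^ 2 := continuous_snd.norm.pow 2
  exact (isOpen_lt h1 continuous_const).inter <| (isOpen_lt h2 continuous_const).inter <|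
    (isOpen_lt h3 continuous_const).inter <| (isOpen_lt continuous_const h4).inter <|
    isOpen_lt h4 continuous_const

theorem isClosed_gadClosedRegion {g : V → V} (hg : ContDiff ℝ 2 g) (M m : ℝ) :
    IsClosed (gadClosedRegion g M m) := by
  have h1 := (hg.continuous.comp (continuous_fst (X := V) (Y := V))).norm
  have h2 := (contDiff_eigenResidual_fderiv hg).continuous.norm
  have h3 := continuous_inner_fderiv_apply hg
  have h4 : Continuous fun z : V × V => ‖z.2‖ ^ 2 := continuous_snd.norm.pow 2
  exact (isClosed_le h1 continuous_const).inter <| (isClosed_le h2 continuous_const).inter <|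
    (isClosed_le h3 continuous_const).inter <| (isClosed_le continuous_const h4).inter <|
    isClosed_le h4 continuous_const

theorem continuous_gadEnergy {g : V → V} (hg : ContDiff ℝ 2 g) (a : ℝ) :
    Continuous (gadEnergy g a) :=
  ((contDiff_eigenResidual_fderiv hg).continuous.norm.pow 2).add
    (((hg.continuous.comp continuous_fst).norm.pow 2).const_mul a)

namespace GADBounds

variable {g : V → V} {M m D : ℝ}

theorem rayleigh_bounds (h : GADBounds g M m D) {z : V × V} (hz : z ∈ gadClosedRegion g M m) :
    ⟪z.2, fderiv ℝ g z.1 z.2⟫_ℝ ≤ -(m / 2) ∧ 3 / 4 ≤ ‖z.2‖ ^ 2 ∧ ‖z.2‖ ^ 2 ≤ 5 / 4 :=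
  rayleigh_bounds_of_norm_eigenResidual_le h.m_pos (h.le_norm _ hz.1 _) hz.2.1 hz.2.2.1
    hz.2.2.2.1 hz.2.2.2.2

theorem coercive (h : GADBounds g M m D) {z : V × V} (hz : z ∈ gadClosedRegion g M m) (y : V) :
    m / 16 * ‖y‖ ^ 2 ≤
      ⟪y, fderiv ℝ g z.1 y⟫_ℝ - 2 * ⟪z.2, y⟫_ℝ * ⟪fderiv ℝ g z.1 z.2, y⟫_ℝ := by
  obtain ⟨e, he⟩ := h.exists_le_inner _ hz.1
  obtain ⟨hq, h1, h2⟩ := h.rayleigh_bounds hz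
  exact le_reflected_form_of_norm_eigenResidual_le (h.isSymmetric _) h.m_pos he hz.2.1 hq h1 h2 y

/-- Exponential decay rate of the gradient. -/
theorem exists_hasDerivAt_norm_sq_le (h : GADBounds g M m D) {ε t : ℝ} {z : ℝ → V × V}
    (hz : z t ∈ gadClosedRegion g M m) (hd : HasDerivAt z (gadField g ε (z t)) t) :
    ∃ f', HasDerivAt (fun s => ‖g (z s).1‖ ^ 2) f' t ∧
      f' ≤ -(m / 8 * ‖g (z t).1‖ ^ 2) := by
  have hg : HasFDerivAt g (fderiv ℝ g (z t).1) (z t).1 :=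
    (h.contDiff.differentiable (by norm_num) _).hasFDerivAt
  have h1 := (hg.comp_hasDerivAt t hd.fst).norm_sq
  refine ⟨_, h1, ?_⟩
  have h2 := h.coercive hz (g (z t).1)
  have h3 := inner_apply_gad_eq (fderiv ℝ g (z t).1) (g (z t).1) (z t).2
  simp only [gadField, Function.comp_apply] at *
  rw [h3]
  linarith

/-- Exponential decay rate of the Lyapunov function. -/
theorem exists_hasDerivAt_gadEnergy_le (h : GADBounds g M m D) {ε t : ℝ} (hε : 0 < ε)
    (hε₁ : ε ≤ 1) {z : ℝ → V × V}
    (hz : z t ∈ gadClosedRegion g M m) (hd : HasDerivAt z (gadField g ε (z t)) t) :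
    ∃ f', HasDerivAt (fun s => gadEnergy g (gadWeight ε m D) (z s)) f' t ∧
      f' ≤ -(m / 16 * gadEnergy g (gadWeight ε m D) (z t)) := by
  obtain ⟨f', hf', hle⟩ := h.exists_hasDerivAt_norm_sq_le hz hd
  have hH : HasFDerivAt (fderiv ℝ g) (fderiv ℝ (fderiv ℝ g) (z t).1) (z t).1 :=
    ((h.contDiff.fderiv_right (m := 1) (by norm_num)).differentiable (by norm_num) _).hasFDerivAt
  have hA := hH.comp_hasDerivAt t hd.fst
  have hw := (hA.eigenResidual hd.snd).norm_sq
  refine ⟨_, hw.add (hf'.const_mul (gadWeight ε m D)), ?_⟩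
  obtain ⟨hq, hv₁, hv₂⟩ := h.rayleigh_bounds hz
  have hm := h.m_pos
  have hB : ‖fderiv ℝ (fderiv ℝ g) (z t).1 (gadField g ε (z t)).1‖ ≤ D * (4 * ‖g (z t).1‖) :=
    (ContinuousLinearMap.le_of_opNorm_le _ (h.norm_le _ hz.1) _).trans
      (mul_le_mul_of_nonneg_left (norm_gadField_fst_le _ _ hv₂) h.D_nonneg)
  have key := inner_eigenResidual_deriv_le (κ := (ε ^ 2)⁻¹) (h.isSymmetric (z t).1)
    (by positivity) (h.coercive hz) hz.2.2.1 hv₂ hB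
  have hκ : 1 ≤ (ε ^ 2)⁻¹ := (one_le_inv₀ (by positivity)).2 (pow_le_one₀ hε.le hε₁)
  simp only [gadField, gadEnergy, Function.comp_apply] at *
  set W := ‖eigenResidual (fderiv ℝ g (z t).1) (z t).2‖
  set G := ‖g (z t).1‖
  -- Young's inequality; `gadWeight` is the weight that makes the difference of the two sides a
  -- perfect square. It spends half of each damping term.
  have hyoung : 2 * (12 * D) * W * G ≤
      (ε ^ 2)⁻¹ * (m / 16) * W ^ 2 + m / 16 * gadWeight ε m D * G ^ 2 := by
    have h1 : (ε ^ 2)⁻¹ * (m / 16) * W ^ 2 + m / 16 * gadWeight ε m D * G ^ 2 -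
        2 * (12 * D) * W * G =
        (m / 16) * (ε⁻¹ * W - ε * (12 * D) / (m / 16) * G) ^ 2 := by
      unfold gadWeight
      field_simp
      ring
    have h2 : 0 ≤ (m / 16) * (ε⁻¹ * W - ε * (12 * D) / (m / 16) * G) ^ 2 := by positivity
    linarith
  have h4 := mul_le_mul_of_nonneg_left hle (gadWeight_nonneg ε m D)
  have h5 : m / 16 * W ^ 2 ≤ (ε ^ 2)⁻¹ * (m / 16) * W ^ 2 := by
    have : 0 ≤ m / 16 * W ^ 2 := by positivity
    nlinarith
  linarith

end GADBounds

end Dynamics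

/-! ### Trapping, global existence and convergence -/

section GlobalDynamics

variable {V : Type*} [NormedAddCommGroup V] [InnerProductSpace ℝ V] {g : V → V} {M m D ε : ℝ}

open scoped InnerProductSpace

/-- The sphere `‖v‖ = 1` is invariant. -/
theorem norm_snd_eq_one_of_mem_gadRegion {z : ℝ → V × V} (hz : Continuous z)
    (hd : ∀ t, 0 ≤ t → HasDerivAt z (gadField g ε (z t)) t)
    (hmem : ∀ t, 0 ≤ t → z t ∈ gadRegion g M m) (h₀ : ‖(z 0).2‖ = 1) {T : ℝ} (hT : 0 ≤ T) :
    ‖(z T).2‖ = 1 := by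
  -- The squared defect has derivative `4 ε⁻² q` times itself; as `q < 0` it cannot grow from `0`.
  have hc : Continuous fun s => (‖(z s).2‖ ^ 2 - 1) ^ 2 :=
    (((continuous_snd.comp hz).norm.pow 2).sub continuous_const).pow 2
  have hderiv : ∀ t ∈ Set.Ioo 0 T, HasDerivAt (fun s => (‖(z s).2‖ ^ 2 - 1) ^ 2)
      (4 * (ε ^ 2)⁻¹ * ⟪(z t).2, fderiv ℝ g (z t).1 (z t).2⟫_ℝ * (‖(z t).2‖ ^ 2 - 1) ^ 2) t := by
    intro t ht
    have h0 : HasDerivAt (fun s => (z s).2) (gadField g ε (z t)).2 t := (hd t ht.1.le).snd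
    have h1 := (h0.norm_sq.sub_const 1).pow 2
    convert! h1 using 1
    simp only [gadField, inner_neg_right, real_inner_smul_right]
    rw [real_inner_comm (eigenResidual _ _), inner_eigenResidual_self]
    push_cast
    ring
  have key := le_mul_exp_of_hasDerivAt_le (k := 0) hc hT hderiv fun t ht => by
    rw [zero_mul, neg_zero]
    exact mul_nonpos_of_nonpos_of_nonneg (mul_nonpos_of_nonneg_of_nonpos (by positivity)
      (hmem t ht.1.le).2.2.1.le) (sq_nonneg _)
  simp only [h₀] at key
  have h1 : (‖(z T).2‖ ^ 2 - 1) ^ 2 = 0 := le_antisymm (by simpa using key) (sq_nonneg _)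
  have h2 : ‖(z T).2‖ ^ 2 = 1 := by
    have := pow_eq_zero_iff (two_ne_zero) |>.1 h1
    linarith
  exact (pow_eq_one_iff_of_nonneg (norm_nonneg _) two_ne_zero).1 h2

namespace GADBounds

theorem norm_sq_le_exp (h : GADBounds g M m D) {T : ℝ} (hT : 0 ≤ T) {z : ℝ → V × V}
    (hz : Continuous z) (hmem : ∀ t ∈ Set.Ico 0 T, z t ∈ gadRegion g M m)
    (hd : ∀ t ∈ Set.Ico 0 T, HasDerivAt z (gadField g ε (z t)) t) :
    ‖g (z T).1‖ ^ 2 ≤ ‖g (z 0).1‖ ^ 2 * Real.exp (-(m / 8 * T)) := by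
  have hc : Continuous fun s => ‖g (z s).1‖ ^ 2 :=
    (h.contDiff.continuous.comp (continuous_fst.comp hz)).norm.pow 2
  have key : ∀ t ∈ Set.Ioo 0 T, ∃ f', HasDerivAt (fun s => ‖g (z s).1‖ ^ 2) f' t ∧
      f' ≤ -(m / 8 * ‖g (z t).1‖ ^ 2) := fun t ht =>
    h.exists_hasDerivAt_norm_sq_le
      (gadRegion_subset_gadClosedRegion _ _ _ (hmem t ⟨ht.1.le, ht.2⟩)) (hd t ⟨ht.1.le, ht.2⟩)
  refine le_mul_exp_of_hasDerivAt_le (f' := deriv fun s => ‖g (z s).1‖ ^ 2) hc hT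
    (fun t ht => ?_) (fun t ht => ?_)
  all_goals obtain ⟨f', h1, h2⟩ := key t ht
  · exact h1.differentiableAt.hasDerivAt
  · rw [h1.deriv]; exact h2

theorem gadEnergy_le_exp (h : GADBounds g M m D) (hε : 0 < ε) (hε₁ : ε ≤ 1) {T : ℝ}
    (hT : 0 ≤ T) {z : ℝ → V × V}
    (hz : Continuous z) (hmem : ∀ t ∈ Set.Ico 0 T, z t ∈ gadRegion g M m)
    (hd : ∀ t ∈ Set.Ico 0 T, HasDerivAt z (gadField g ε (z t)) t) :
    gadEnergy g (gadWeight ε m D) (z T) ≤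
      gadEnergy g (gadWeight ε m D) (z 0) * Real.exp (-(m / 16 * T)) := by
  have hc : Continuous fun s => gadEnergy g (gadWeight ε m D) (z s) :=
    (continuous_gadEnergy h.contDiff _).comp hz
  have key : ∀ t ∈ Set.Ioo 0 T, ∃ f',
      HasDerivAt (fun s => gadEnergy g (gadWeight ε m D) (z s)) f' t ∧
      f' ≤ -(m / 16 * gadEnergy g (gadWeight ε m D) (z t)) := fun t ht =>
    h.exists_hasDerivAt_gadEnergy_le hε hε₁
      (gadRegion_subset_gadClosedRegion _ _ _ (hmem t ⟨ht.1.le, ht.2⟩)) (hd t ⟨ht.1.le, ht.2⟩)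
  refine le_mul_exp_of_hasDerivAt_le
    (f' := deriv fun s => gadEnergy g (gadWeight ε m D) (z s)) hc hT
    (fun t ht => ?_) (fun t ht => ?_)
  all_goals obtain ⟨f', h1, h2⟩ := key t ht
  · exact h1.differentiableAt.hasDerivAt
  · rw [h1.deriv]; exact h2

/-- A curve that follows the dynamics as long as it is in the trapping region and starts well
inside it never leaves it. -/
theorem mem_gadRegion (h : GADBounds g M m D) (hε : 0 < ε) (hε₁ : ε ≤ 1) {z : ℝ → V × V}
    (hz : Continuous z)
    (hd : ∀ t, z t ∈ gadRegion g M m → HasDerivAt z (gadField g ε (z t)) t)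
    (h₀ : z 0 ∈ gadRegion g M m)
    (henergy : gadEnergy g (gadWeight ε m D) (z 0) < (m / 16) ^ 2) :
    ∀ t, 0 ≤ t → z t ∈ gadRegion g M m := by
  have hm := h.m_pos
  refine forall_mem_of_isOpen_of_forall_Ico hz (isOpen_gadRegion h.contDiff M m) h₀
    fun T hT hmem => ?_
  -- At a first exit time only the nonstrict bounds survive. `rayleigh_bounds` then restores those
  -- on `q` and `‖v‖` strictly, and the decay estimates restore those on `g` and `w`.
  have hcl : z T ∈ gadClosedRegion g M m := by
    have hTc : T ∈ closure (Set.Ico 0 T) := by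
      rw [closure_Ico hT.ne]; exact ⟨hT.le, le_rfl⟩
    have := map_mem_closure hz hTc fun t ht =>
      gadRegion_subset_gadClosedRegion g M m (hmem t ht)
    rwa [(isClosed_gadClosedRegion h.contDiff M m).closure_eq] at this
  obtain ⟨hq, hv₁, hv₂⟩ := h.rayleigh_bounds hcl
  have hd' : ∀ t ∈ Set.Ico 0 T, HasDerivAt z (gadField g ε (z t)) t :=
    fun t ht => hd t (hmem t ht)
  have h1 := h.norm_sq_le_exp hT.le hz hmem hd'
  have h2 := h.gadEnergy_le_exp hε hε₁ hT.le hz hmem hd'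
  refine ⟨?_, ?_, by linarith, by linarith, by linarith⟩
  · refine lt_of_le_of_lt (abs_le_of_sq_le_sq' (h1.trans ?_) (norm_nonneg _)).2 h₀.1
    exact mul_le_of_le_one_right (sq_nonneg _) (Real.exp_le_one_iff.2 (by
      have := mul_pos hm hT; linarith))
  · refine lt_of_pow_lt_pow_left₀ 2 (by positivity) (lt_of_le_of_lt ?_ henergy)
    have h3 : 0 ≤ gadEnergy g (gadWeight ε m D) (z 0) := by
      have := gadWeight_nonneg ε m D
      unfold gadEnergy; positivity
    have h4 : gadEnergy g (gadWeight ε m D) (z T) ≤ gadEnergy g (gadWeight ε m D) (z 0) :=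
      h2.trans (mul_le_of_le_one_right h3 (Real.exp_le_one_iff.2 (by
        have := mul_pos hm hT; linarith)))
    refine le_trans ?_ h4
    exact le_add_of_nonneg_right (mul_nonneg (gadWeight_nonneg ε m D) (sq_nonneg _))

/-- A trapped trajectory converges to a critical point together with a unit eigenvector of negative
eigenvalue. -/
theorem exists_tendsto [FiniteDimensional ℝ V] (h : GADBounds g M m D) (hε : 0 < ε) (hε₁ : ε ≤ 1)
    {z : ℝ → V × V} (hz : Continuous z)
    (hd : ∀ t, 0 ≤ t → HasDerivAt z (gadField g ε (z t)) t)
    (hmem : ∀ t, 0 ≤ t → z t ∈ gadRegion g M m) :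
    ∃ l : V × V, Tendsto z atTop (𝓝 l) ∧ g l.1 = 0 ∧ ‖l.2‖ = 1 ∧
      ⟪l.2, fderiv ℝ g l.1 l.2⟫_ℝ < 0 ∧
      fderiv ℝ g l.1 l.2 = ⟪l.2, fderiv ℝ g l.1 l.2⟫_ℝ • l.2 := by
  have hm := h.m_pos
  -- The energy rate `m / 16` becomes `m / 32` for norms; the faster decay of `g` is weakened to the
  -- same rate.
  have hexp : ∀ t : ℝ, Real.exp (-(m / 16 * t)) = Real.exp (-(m / 32) * t) ^ 2 := fun t => by
    rw [← Real.exp_nat_mul]; congr 1; push_cast; ring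
  set G := ‖g (z 0).1‖ with hG
  set Φ := gadEnergy g (gadWeight ε m D) (z 0) with hΦ
  have hΦ0 : 0 ≤ Φ := by
    have := gadWeight_nonneg ε m D
    rw [hΦ]; unfold gadEnergy; positivity
  have hg_le : ∀ t, 0 ≤ t → ‖g (z t).1‖ ≤ G * Real.exp (-(m / 32) * t) := by
    intro t ht
    have h1 := h.norm_sq_le_exp ht hz (fun s hs => hmem s hs.1) (fun s hs => hd s hs.1)
    refine (abs_le_of_sq_le_sq' (h1.trans ?_) (by positivity)).2
    rw [mul_pow, ← hexp]
    gcongr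
    nlinarith
  have hw_le : ∀ t, 0 ≤ t → ‖eigenResidual (fderiv ℝ g (z t).1) (z t).2‖ ≤
      √Φ * Real.exp (-(m / 32) * t) := by
    intro t ht
    have h1 := h.gadEnergy_le_exp hε hε₁ ht hz (fun s hs => hmem s hs.1) (fun s hs => hd s hs.1)
    refine (abs_le_of_sq_le_sq' (le_trans ?_ (h1.trans ?_)) (by positivity)).2
    · exact le_add_of_nonneg_right (mul_nonneg (gadWeight_nonneg ε m D) (sq_nonneg _))
    · rw [mul_pow, ← hexp, Real.sq_sqrt hΦ0]
  obtain ⟨l, hl⟩ := exists_tendsto_of_norm_deriv_le_exp (z := z)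
    (z' := fun t => gadField g ε (z t)) (C := 4 * G + (ε ^ 2)⁻¹ * √Φ) (k := m / 32)
    (by positivity) hd ((contDiff_gadField h.contDiff ε).continuous.comp hz).continuousOn (by
      intro t ht
      have hv := (h.rayleigh_bounds (gadRegion_subset_gadClosedRegion _ _ _ (hmem t ht))).2.2
      refine (Prod.norm_def _).trans_le (max_le ?_ ?_)
      · refine (norm_gadField_fst_le _ _ hv).trans ?_
        have := hg_le t ht
        have h2 : 0 ≤ (ε ^ 2)⁻¹ * √Φ * Real.exp (-(m / 32) * t) := by positivity
        linarith
      · simp only [gadField, norm_smul, norm_neg]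
        rw [Real.norm_of_nonneg (by positivity)]
        have := mul_le_mul_of_nonneg_left (hw_le t ht) (inv_nonneg.2 (sq_nonneg ε))
        have h2 : 0 ≤ 4 * G * Real.exp (-(m / 32) * t) := by positivity
        linarith)
  have hzero : ∀ C : ℝ, Tendsto (fun t => C * Real.exp (-(m / 32) * t)) atTop (𝓝 0) := fun C => by
    have h1 : Tendsto (fun t : ℝ => -(m / 32) * t) atTop atBot :=
      tendsto_id.const_mul_atTop_of_neg (by linarith)
    simpa using (Real.tendsto_exp_atBot.comp h1).const_mul C
  have hgl : g l.1 = 0 :=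
    tendsto_nhds_unique ((h.contDiff.continuous.tendsto _).comp
      ((continuous_fst.tendsto l).comp hl)) (squeeze_zero_norm'
        (eventually_atTop.2 ⟨0, fun t ht => hg_le t ht⟩) (hzero G))
  have hwl : eigenResidual (fderiv ℝ g l.1) l.2 = 0 :=
    tendsto_nhds_unique (((contDiff_eigenResidual_fderiv h.contDiff).continuous.tendsto l).comp hl)
      (squeeze_zero_norm' (eventually_atTop.2 ⟨0, fun t ht => hw_le t ht⟩) (hzero √Φ))
  have hlmem : l ∈ gadClosedRegion g M m :=
    (isClosed_gadClosedRegion h.contDiff M m).mem_of_tendsto hl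
      (eventually_atTop.2 ⟨0, fun t ht => gadRegion_subset_gadClosedRegion _ _ _ (hmem t ht)⟩)
  have hq : ⟪l.2, fderiv ℝ g l.1 l.2⟫_ℝ < 0 := by linarith [(h.rayleigh_bounds hlmem).1]
  refine ⟨l, hl, hgl, ?_, hq, sub_eq_zero.1 hwl⟩
  -- With `w = 0` and `q ≠ 0` the identity forces `‖v‖ = 1` in the limit, even if `‖v₀‖ ≠ 1`.
  have h1 := inner_eigenResidual_self (fderiv ℝ g l.1) l.2
  rw [hwl, inner_zero_left] at h1
  have h2 := (mul_eq_zero.1 h1.symm).resolve_left hq.ne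
  exact (pow_eq_one_iff_of_nonneg (norm_nonneg _) two_ne_zero).1 (by linarith)

/-- Global existence and convergence of the dynamics started in the trapping region. -/
theorem exists_solution [FiniteDimensional ℝ V] (h : GADBounds g M m D) (hε : 0 < ε)
    (hε₁ : ε ≤ 1) (hbdd : Bornology.IsBounded {x | ‖g x‖ ≤ M}) {z₀ : V × V}
    (h₀ : z₀ ∈ gadRegion g M m) (henergy : gadEnergy g (gadWeight ε m D) z₀ < (m / 16) ^ 2) :
    ∃ z : ℝ → V × V, z 0 = z₀ ∧ (∀ t, 0 ≤ t → HasDerivAt z (gadField g ε (z t)) t) ∧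
      (‖z₀.2‖ = 1 → ∀ t, 0 ≤ t → ‖(z t).2‖ = 1) ∧
      ∃ l : V × V, Tendsto z atTop (𝓝 l) ∧ g l.1 = 0 ∧ ‖l.2‖ = 1 ∧
        ⟪l.2, fderiv ℝ g l.1 l.2⟫_ℝ < 0 ∧
        fderiv ℝ g l.1 l.2 = ⟪l.2, fderiv ℝ g l.1 l.2⟫_ℝ • l.2 := by
  -- A radius above `2` also covers the directions, since `‖v‖² < 2` in the region.
  obtain ⟨R, hR0, hR⟩ := hbdd.subset_closedBall_lt 2 0
  let χ : ContDiffBump (0 : V × V) := ⟨R, R + 1, by linarith, by linarith⟩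
  have hχ : ∀ z ∈ gadRegion g M m, χ z = 1 := by
    intro z hz
    refine χ.one_of_mem_closedBall ?_
    rw [mem_closedBall_zero_iff]
    refine (Prod.norm_def _).trans_le (max_le ?_ ?_)
    · exact mem_closedBall_zero_iff.1 (hR hz.1.le)
    · refine le_trans ?_ hR0.le
      nlinarith [hz.2.2.2.2, norm_nonneg z.2]
  -- The cut-off field is bounded and globally Lipschitz, so it has a global curve; trapping shows
  -- that the cut-off is never felt for `t ≥ 0`.
  have hsm : ContDiff ℝ 1 fun z => χ z • gadField g ε z :=
    χ.contDiff.smul (contDiff_gadField h.contDiff ε)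
  have hcs : HasCompactSupport fun z => χ z • gadField g ε z := χ.hasCompactSupport.smul_right
  obtain ⟨K, hK⟩ := hsm.lipschitzWith_of_hasCompactSupport hcs one_ne_zero
  obtain ⟨L, hL⟩ := hcs.exists_bound_of_continuous hsm.continuous
  obtain ⟨z, hz0, hzd⟩ := exists_forall_hasDerivAt_of_lipschitzWith_of_bounded
    (L := L.toNNReal) hK (fun z => (hL z).trans (Real.le_coe_toNNReal L)) z₀
  have hzc : Continuous z := continuous_iff_continuousAt.2 fun t => (hzd t).continuousAt
  have hd : ∀ t, z t ∈ gadRegion g M m → HasDerivAt z (gadField g ε (z t)) t := fun t ht => by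
    have := hzd t
    rwa [hχ _ ht, one_smul] at this
  rw [← hz0] at h₀ henergy ⊢
  have hmem := h.mem_gadRegion hε hε₁ hzc hd h₀ henergy
  exact ⟨z, rfl, fun t ht => hd t (hmem t ht), fun h1 t ht =>
    norm_snd_eq_one_of_mem_gadRegion hzc (fun t ht => hd t (hmem t ht)) hmem h1 ht,
    h.exists_tendsto hε hε₁ hzc (fun t ht => hd t (hmem t ht)) hmem⟩

end GADBounds

end GlobalDynamics

/-! ### Uniform constants by compactness -/

section Compactness

variable {V : Type*} [NormedAddCommGroup V] [InnerProductSpace ℝ V] [FiniteDimensional ℝ V]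

open scoped InnerProductSpace

/-- By homogeneity it suffices to bound `‖A x y‖` below on the product of `K` with the unit sphere,
where it is continuous and positive. -/
theorem IsCompact.exists_pos_forall_mul_norm_le {X : Type*} [TopologicalSpace X] {K : Set X}
    (hK : IsCompact K) {A : X → V →L[ℝ] V} (hA : Continuous A)
    (hinj : ∀ x ∈ K, ∀ y, A x y = 0 → y = 0) :
    ∃ m, 0 < m ∧ ∀ x ∈ K, ∀ y, m * ‖y‖ ≤ ‖A x y‖ := by
  have hc : Continuous fun p : X × V => ‖A p.1 p.2‖ :=
    ((hA.comp continuous_fst).clm_apply continuous_snd).norm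
  obtain ⟨m, hm, hle⟩ := (hK.prod (isCompact_sphere (0 : V) 1)).exists_forall_le'
    hc.continuousOn (a := 0) fun p hp => norm_pos_iff.2 fun h => by
      have h1 : ‖p.2‖ = 1 := mem_sphere_zero_iff_norm.1 hp.2
      rw [hinj _ hp.1 _ h, norm_zero] at h1
      exact zero_ne_one h1
  refine ⟨m, hm, fun x hx y => ?_⟩
  rcases eq_or_ne y 0 with rfl | hy
  · simp
  have hy' : 0 < ‖y‖ := norm_pos_iff.2 hy
  have h1 := hle (x, ‖y‖⁻¹ • y) ⟨hx, by simp [norm_smul, hy'.ne']⟩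
  simp only [map_smul, norm_smul, norm_inv, norm_norm] at h1
  rwa [inv_mul_eq_div, le_div_iff₀ hy'] at h1

/-- Directions close to a unit eigenvector for an eigenvalue at most `-m` are well inside the
trapping region, uniformly for positions in a bounded set. -/
theorem exists_pos_forall_mem_gadRegion {g : V → V} (hg : ContDiff ℝ 2 g) {r M m : ℝ}
    (hm : 0 < m) (hM : ∀ x, ‖x‖ ≤ r → ‖g x‖ < M) :
    ∃ δ, 0 < δ ∧ ∀ (x v w : V) (μ : ℝ), ‖x‖ ≤ r → ‖w‖ = 1 → fderiv ℝ g x w = μ • w →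
      μ ≤ -m → ‖v - w‖ ≤ δ → (x, v) ∈ gadRegion g M m ∧
        ‖eigenResidual (fderiv ℝ g x) v‖ < m / 32 := by
  have hK : IsCompact (Metric.closedBall (0 : V) r ×ˢ Metric.closedBall (0 : V) 2) :=
    (isCompact_closedBall _ _).prod (isCompact_closedBall _ _)
  have hc : Continuous fun z : V × V => (eigenResidual (fderiv ℝ g z.1) z.2,
      ⟪z.2, fderiv ℝ g z.1 z.2⟫_ℝ, ‖z.2‖ ^ 2) :=
    (contDiff_eigenResidual_fderiv hg).continuous.prodMk
      ((continuous_inner_fderiv_apply hg).prodMk (continuous_snd.norm.pow 2))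
  -- At the exact eigenvector `(x, w)` the three quantities are `0`, `μ ≤ -m` and `1`; uniform
  -- continuity transfers them to `(x, v)` with a `δ` independent of `x`.
  obtain ⟨δ, hδ, hunif⟩ := Metric.uniformContinuousOn_iff.1
    (hK.uniformContinuousOn_of_continuous hc.continuousOn) (min (m / 32) (1 / 4)) (by positivity)
  refine ⟨min (δ / 2) 1, by positivity, fun x v w μ hx hw hμ hμm hvw => ?_⟩
  have hv : ‖v‖ ≤ 2 := by
    calc ‖v‖ = ‖(v - w) + w‖ := by rw [sub_add_cancel]
      _ ≤ ‖v - w‖ + ‖w‖ := norm_add_le _ _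
      _ ≤ 1 + 1 := add_le_add (hvw.trans (min_le_right _ _)) hw.le
      _ = 2 := by norm_num
  have hqw : ⟪w, fderiv ℝ g x w⟫_ℝ = μ := by
    rw [hμ, real_inner_smul_right, real_inner_self_eq_norm_sq, hw]; ring
  have hrw : eigenResidual (fderiv ℝ g x) w = 0 := by
    rw [eigenResidual, hqw, hμ, sub_self]
  have hdist := hunif (x, v) ⟨by simpa using hx, by simpa using hv⟩ (x, w)
    ⟨by simpa using hx, by simp [hw]⟩ (by
      rw [Prod.dist_eq, dist_self, max_eq_right dist_nonneg, dist_eq_norm]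
      have := hvw.trans (min_le_left _ _)
      linarith)
  simp only [Prod.dist_eq, max_lt_iff, lt_min_iff, hrw, hqw, hw, dist_zero_right, Real.dist_eq,
    abs_lt] at hdist
  obtain ⟨⟨h1, ⟨-, h2⟩, -⟩, -, -, h3⟩ := hdist
  exact ⟨⟨hM x hx, h1.trans (by linarith), by
    change ⟪v, fderiv ℝ g x v⟫_ℝ < 0
    linarith, by
    change 1 / 2 < ‖v‖ ^ 2
    linarith, by
    change ‖v‖ ^ 2 < 2
    linarith⟩, h1⟩

end Compactness

/-! ### Application to the energy -/

theorem contDiff_gradient {N : ℕ} {E : EuclideanSpace ℝ (Fin N) → ℝ} (hE : ContDiff ℝ 3 E) :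
    ContDiff ℝ 2 (gradient E) :=
  (InnerProductSpace.toDual ℝ (EuclideanSpace ℝ (Fin N))).symm.contDiff.comp
    (hE.fderiv_right (m := 2) (by norm_num))

theorem isGADSolution_iff {N : ℕ} {E : EuclideanSpace ℝ (Fin N) → ℝ} {ε : ℝ}
    {x₀ v₀ : EuclideanSpace ℝ (Fin N)} {x v : ℝ → EuclideanSpace ℝ (Fin N)} :
    IsGADSolution E ε x₀ v₀ x v ↔ (x 0, v 0) = (x₀, v₀) ∧ ∀ t, 0 ≤ t →
      HasDerivWithinAt (fun s => (x s, v s)) (gadField (gradient E) ε (x t, v t))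
        (Set.Ici 0) t := by
  constructor
  · exact fun h => ⟨Prod.ext h.init_x h.init_v,
      fun t ht => (h.deriv_x t ht).prodMk (h.deriv_v t ht)⟩
  · exact fun h => ⟨congrArg Prod.fst h.1, congrArg Prod.snd h.1, fun t ht => (h.2 t ht).fst,
      fun t ht => (h.2 t ht).snd⟩

theorem mainTheorem3 {N : ℕ} (hN : 1 ≤ N) (E : EuclideanSpace ℝ (Fin N) → ℝ)
    (hE : ContDiff ℝ 3 E)
    (hlam₁ : ∀ x, hessianEigenvalue (hE.of_le (by norm_num)) x ⟨0, hN⟩ < 0)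
    (hlam₂ : ∀ (h : 2 ≤ N) (x), 0 < hessianEigenvalue (hE.of_le (by norm_num)) x ⟨1, h⟩)
    (hgrad : Tendsto (fun x => ‖gradient E x‖) (Bornology.cobounded _) atTop) :
    ∀ r : ℝ, 0 < r → ∃ ε_r : ℝ, 0 < ε_r ∧ ∃ δ_r : ℝ, 0 < δ_r ∧
      ∀ ε : ℝ, 0 < ε → ε ≤ ε_r →
      ∀ x₀ v₀ v₁ : EuclideanSpace ℝ (Fin N), ‖x₀‖ ≤ r →
        IsLowestEigenvector hN (hE.of_le (by norm_num)) x₀ v₁ → ‖v₀ - v₁‖ ≤ δ_r →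
        ∃ x v : ℝ → EuclideanSpace ℝ (Fin N),
          IsGADSolution E ε x₀ v₀ x v ∧
          (∀ y w : ℝ → EuclideanSpace ℝ (Fin N), IsGADSolution E ε x₀ v₀ y w →
            ∀ t, 0 ≤ t → y t = x t ∧ w t = v t) ∧
          (‖v₀‖ = 1 → ∀ t, 0 ≤ t → ‖v t‖ = 1) ∧
          ∃ x_s v_s : EuclideanSpace ℝ (Fin N),
            IsIndexOneSaddle (hE.of_le (by norm_num)) x_s ∧
            IsLowestEigenvector hN (hE.of_le (by norm_num)) x_s v_s ∧
            Tendsto x atTop (𝓝 x_s) ∧ Tendsto v atTop (𝓝 v_s) := by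
  intro r hr
  have hE₂ : ContDiff ℝ 2 E := hE.of_le (by norm_num)
  have hg := contDiff_gradient hE
  have hpos : ∀ x j, j ≠ ⟨0, hN⟩ → 0 < hessianEigenvalue hE₂ x j := fun x j hj =>
    hessianEigenvalue_pos hN (fun h => hlam₂ h x) hj
  have hne : ∀ x j, hessianEigenvalue hE₂ x j ≠ 0 := fun x j => by
    by_cases hj : j = ⟨0, hN⟩
    · rw [hj]; exact (hlam₁ x).ne
    · exact (hpos x j hj).ne'
  obtain ⟨M, hM⟩ :=
    (isCompact_closedBall (0 : EuclideanSpace ℝ (Fin N)) r).exists_bound_of_continuousOn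
      hg.continuous.continuousOn
  have hM' : ∀ x, ‖x‖ ≤ r → ‖gradient E x‖ ≤ M := fun x hx =>
    hM x (mem_closedBall_zero_iff.2 hx)
  have hM0 : 0 ≤ M := (norm_nonneg _).trans (hM' 0 (by simpa using hr.le))
  -- The level `M + 1` leaves room for the strict inequality required of the initial state.
  have hbdd : Bornology.IsBounded {x | ‖gradient E x‖ ≤ M + 1} := by
    rw [Bornology.isBounded_def]
    filter_upwards [hgrad.eventually_gt_atTop (M + 1)] with x hx
    exact not_le.2 hx
  have hK : IsCompact {x | ‖gradient E x‖ ≤ M + 1} :=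
    Metric.isCompact_of_isClosed_isBounded (isClosed_le hg.continuous.norm continuous_const) hbdd
  obtain ⟨m, hm, hmle⟩ := hK.exists_pos_forall_mul_norm_le
    (hg.continuous_fderiv (by norm_num)) fun x _ y hy => hessian_injective (hne x) hy
  obtain ⟨D, hD⟩ := hK.exists_bound_of_continuousOn
    (((hg.fderiv_right (m := 1) (by norm_num)).continuous_fderiv (by norm_num)).continuousOn)
  have hD0 : 0 ≤ D := (norm_nonneg _).trans
    (hD 0 ((hM' 0 (by simpa using hr.le)).trans (by linarith)))
  have hbounds : GADBounds (gradient E) (M + 1) m D :=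
    { contDiff := hg
      isSymmetric := hessian_isSymmetric hE₂
      m_pos := hm
      D_nonneg := hD0
      le_norm := hmle
      exists_le_inner := fun x hx =>
        ⟨_, fun z hz => le_inner_hessian_of_inner_eq_zero (hpos x) (hmle x hx) hz⟩
      norm_le := hD }
  obtain ⟨δ, hδ, hδmem⟩ := exists_pos_forall_mem_gadRegion hg (r := r) (M := M + 1) hm
    fun x hx => (hM' x hx).trans_lt (lt_add_one M)
  -- This makes the gradient part of the initial energy at most `(m / 32)²`; with the residual part
  -- below `(m / 32)²` the sum is under `(m / 16)²`. The `+ 1` guards against `D * M = 0`.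
  refine ⟨min 1 (m / 16 * (m / 32) / (12 * D * M + 1)), by positivity, δ, hδ, ?_⟩
  intro ε hε hεle x₀ v₀ v₁ hx₀ hv₁ hv₀
  -- The constant `m` bounds `‖A y‖ / ‖y‖` from below, hence `|λ₁|`; the sign of `λ₁` does the rest.
  have hμ : hessianEigenvalue hE₂ x₀ ⟨0, hN⟩ ≤ -m := by
    have h1 := hmle x₀ ((hM' x₀ hx₀).trans (by linarith)) v₁
    rw [show fderiv ℝ (gradient E) x₀ v₁ = _ from hv₁.2, norm_smul, hv₁.1,
      Real.norm_of_nonpos (hlam₁ x₀).le] at h1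
    linarith
  obtain ⟨hmem, hres⟩ := hδmem x₀ v₀ v₁ _ hx₀ hv₁.1 hv₁.2 hμ hv₀
  have henergy : gadEnergy (gradient E) (gadWeight ε m D) (x₀, v₀) < (m / 16) ^ 2 := by
    have h1 : ε * (12 * D * M + 1) ≤ m / 16 * (m / 32) :=
      (le_div_iff₀ (by positivity)).1 (hεle.trans (min_le_right _ _))
    have h2 : ε * (12 * D) / (m / 16) * ‖gradient E x₀‖ ≤ m / 32 := by
      rw [div_mul_eq_mul_div, div_le_iff₀ (by positivity)]
      have : ε * (12 * D) * ‖gradient E x₀‖ ≤ ε * (12 * D) * M := by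
        gcongr; exact hM' x₀ hx₀
      linarith
    have h3 : gadWeight ε m D * ‖gradient E x₀‖ ^ 2 ≤ (m / 32) ^ 2 := by
      calc _ = (ε * (12 * D) / (m / 16) * ‖gradient E x₀‖) ^ 2 := by
            rw [gadWeight]; ring
        _ ≤ _ := by gcongr
    have h4 : ‖eigenResidual (fderiv ℝ (gradient E) x₀) v₀‖ ^ 2 < (m / 32) ^ 2 := by gcongr
    unfold gadEnergy
    nlinarith
  obtain ⟨z, hz0, hzd, hnorm, l, hl, hgl, hl1, hlq, hleig⟩ :=
    hbounds.exists_solution hε (hεle.trans (min_le_left _ _)) hbdd hmem henergy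
  have hzsol : ∀ t, 0 ≤ t →
      HasDerivWithinAt z (gadField (gradient E) ε (z t)) (Set.Ici 0) t :=
    fun t ht => (hzd t ht).hasDerivWithinAt
  refine ⟨fun t => (z t).1, fun t => (z t).2, isGADSolution_iff.2 ⟨hz0, hzsol⟩, ?_, hnorm,
    l.1, l.2, ⟨hgl, ⟨0, hN⟩, hlam₁ _, hpos _⟩, ⟨hl1, ?_⟩, (continuous_fst.tendsto l).comp hl,
    (continuous_snd.tendsto l).comp hl⟩
  · intro y w hyw t ht
    obtain ⟨hyw0, hywd⟩ := isGADSolution_iff.1 hyw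
    exact Prod.ext_iff.1 (eq_of_hasDerivWithinAt_Ici_of_contDiff (contDiff_gadField hg ε)
      (hyw0.trans hz0.symm) hywd hzsol ht)
  · rw [← eq_hessianEigenvalue_of_neg (hpos l.1) hlq (norm_ne_zero_iff.1 (by simp [hl1])) hleig]
    exact hleig
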